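/- A \emph{convex drawing} of a finite graph $G$ places the vertices of $G$ on pairwise different points of a circle in the plane and draws each edge as the straight-line segment between its ends; two different edges cross if their segments have a common point that is not an end of either segment. For an integer $k \ge 0$, the graph $G$ is \emph{outer $k$-planar} if it has a convex drawing in which every edge crosses at most $k$ other edges. A \emph{tree decomposition} of $G$ is a finite tree with a bag (a set of vertices of $G$) at each node, such that every edge of $G$ lies in some bag and, for every vertex $v$ of $G$, the nodes whose bags contain $v$ form a nonempty subtree; its \emph{width} is the largest size of a bag minus one. The \emph{treewidth} $\mathrm{tw}(G)$ is the minimum width of a tree decomposition of $G$. In the game of cops and robber on $G$, $c$ cops choose their initial vertices, then the robber chooses a vertex; in each round first every cop stays or moves to an adjacent vertex, and then the robber stays or moves to an adjacent vertex. All positions are known to both players, several cops may share a vertex, and the cops win if after finitely many rounds a cop is on the robber's vertex. The \emph{cop number} $\mathrm{cop}(G)$ is the minimum $c$ for which $c$ cops can force a win. Theorem. Let $k \ge 0$ be an integer and let $G$ be a finite simple outer $k$-planar graph. Then $$\mathrm{tw}(G) \le 1.5k + 2.$$ If, moreover, $G$ is connected, then $$\mathrm{cop}(G) \le 0.75k +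 2,$$ and, if $k$ is not a multiple of $4$, even $$\mathrm{cop}(G) \le 0.75k + 1.75.$$ -/

import Mathlib

namespace OuterKPlanar

/-! ### Convex drawings and outer `k`-planar graphs -/

/-- A convex drawing of a graph with vertex set `V`: the vertices are placed on pairwise different
points of a circle in the plane `ℂ`. The edges are the straight-line segments between their ends,
so they need not be recorded. -/
structure ConvexDrawing (V : Type*) where
  pos : V → ℂ
  center : ℂ
  radius : ℝ
  radius_pos : 0 < radius
  pos_mem : ∀ v, pos v ∈ Metric.sphere center radius
  pos_injective : Function.Injective pos

/-- Two different edges cross in a convex drawing if the corresponding straight-line segments have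
a common point that is not an end of either of them. -/
def ConvexDrawing.Crosses {V : Type*} (D : ConvexDrawing V) (e f : Sym2 V) : Prop :=
  e ≠ f ∧ ∃ a b c d : V, e = s(a, b) ∧ f = s(c, d) ∧
    (openSegment ℝ (D.pos a) (D.pos b) ∩ openSegment ℝ (D.pos c) (D.pos d)).Nonempty

/-- A convex drawing of `G` is outer `k`-planar if every edge of `G` crosses at most `k` other
edges of `G`. -/
def ConvexDrawing.IsOuterKPlanar {V : Type*} (D : ConvexDrawing V) (G : SimpleGraph V) (k : ℕ) :
    Prop :=
  ∀ e ∈ G.edgeSet, {f ∈ G.edgeSet | D.Crosses e f}.encard ≤ k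

/-- A graph is outer `k`-planar if it has an outer `k`-planar drawing. -/
def IsOuterKPlanar {V : Type*} (G : SimpleGraph V) (k : ℕ) : Prop :=
  ∃ D : ConvexDrawing V, D.IsOuterKPlanar G k

/-! ### Treewidth -/

/-- A tree decomposition of `G`: a finite tree with a bag of vertices of `G` at each node, such
that every edge of `G` lies in some bag and, for every vertex `v` of `G`, the nodes whose bags
contain `v` induce a subtree (a nonempty connected subgraph of the tree). -/
structure TreeDecomposition {V : Type*} (G : SimpleGraph V) where
  ι : Type
  fintypeNodes : Fintype ι
  tree : SimpleGraph ι
  isTree : tree.IsTree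
  bag : ι → Finset V
  edge_mem_bag : ∀ u v, G.Adj u v → ∃ i, u ∈ bag i ∧ v ∈ bag i
  connected_nodes : ∀ v, (tree.induce {i | v ∈ bag i}).Connected

attribute [instance] TreeDecomposition.fintypeNodes

/-- The width is the largest size of a bag minus one (and `0` if all bags are empty, which is
possible only for the graph without vertices). -/
def TreeDecomposition.width {V : Type*} {G : SimpleGraph V} (D : TreeDecomposition G) : ℕ :=
  (Finset.univ.sup fun i => (D.bag i).card) - 1

/-- The treewidth of a finite graph: the minimum width of a tree decomposition. -/
noncomputable def treewidth {V : Type*} (G : SimpleGraph V) : ℕ :=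
  sInf {w | ∃ D : TreeDecomposition G, D.width = w}

/-- The minimum in the definition of treewidth is over a nonempty set. -/
theorem exists_treeDecomposition {V : Type*} [Finite V] (G : SimpleGraph V) :
    {w | ∃ D : TreeDecomposition G, D.width = w}.Nonempty := by
  classical
  have := Fintype.ofFinite V
  refine ⟨_, ⟨Unit, inferInstance, ⊥, SimpleGraph.IsTree.of_subsingleton, fun _ => Finset.univ,
    fun u v _ => ⟨(), by simp⟩, fun v => ?_⟩, rfl⟩
  have : Nonempty ({i | v ∈ (fun _ : Unit => (Finset.univ : Finset V)) i} : Set Unit) :=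
    ⟨⟨(), by simp⟩⟩
  exact SimpleGraph.Connected.mk fun a b => by
    rw [Subsingleton.elim a b]

/-! ### The game of cops and robber -/

/-- A move of `c` cops: each of them stays or goes to an adjacent vertex. -/
def CopsMove {V : Type*} (G : SimpleGraph V) {c : ℕ} (p p' : Fin c → V) : Prop :=
  ∀ i, p' i = p i ∨ G.Adj (p i) (p' i)

/-- `CopsCatch G p r` says that `c` cops at the positions `p`, being the next to move, can force
the capture of a robber at `r` in finitely many rounds. In a round, first all cops move, and the
robber is caught if a cop is then on the robber's vertex; otherwise the robber stays or goes to an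
adjacent vertex. (A robber who goes to a vertex with a cop is caught in the next round, by a cop
who stays.) -/
inductive CopsCatch {V : Type*} (G : SimpleGraph V) {c : ℕ} : (Fin c → V) → V → Prop
  | capture (p p' : Fin c → V) (r : V) (hmove : CopsMove G p p') (i : Fin c) (hi : p' i = r) :
      CopsCatch G p r
  | step (p p' : Fin c → V) (r : V) (hmove : CopsMove G p p')
      (h : ∀ r', r' = r ∨ G.Adj r r' → CopsCatch G p' r') :
      CopsCatch G p r

/-- `c` cops win on `G` if they can choose initial positions such that, whichever initial vertex
the robber then chooses, they can force the capture. -/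
def CopsWin {V : Type*} (G : SimpleGraph V) (c : ℕ) : Prop :=
  ∃ p : Fin c → V, ∀ r, CopsCatch G p r

/-- The cop number of a finite graph: the minimum number of cops that win. -/
noncomputable def copNumber {V : Type*} (G : SimpleGraph V) : ℕ :=
  sInf {c | CopsWin G c}

/-- The minimum in the definition of the cop number is over a nonempty set. -/
theorem exists_copsWin {V : Type*} [Finite V] (G : SimpleGraph V) :
    {c | CopsWin G c}.Nonempty := by
  obtain ⟨n, ⟨e⟩⟩ := Finite.exists_equiv_fin V
  exact ⟨n, e.symm, fun r =>
    .capture _ e.symm r (fun _ => Or.inl rfl) (e r) (e.symm_apply_apply r)⟩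

end OuterKPlanar

/-!
An arbitrary chord of the circle may be crossed by many edges, but the polygon that the vertices
form can be triangulated so that every side of every triangle is crossed by at most `k` edges: the
part of it beyond such a chord can be split at an end of a maximal edge that passes over a suitable
vertex. Walk through the triangulation, occupying the corners of the current triangle and one end of
each edge that crosses two of its sides. There are at most `3k/2` such edges, hence at most
`3k/2 + 3` occupied vertices, and this bound can be kept on the way from a triangle to the next.

The sets of occupied vertices form the bags of a tree decomposition. They are also positions from
which cops confine the robber to a shrinking territory: a cop who shadows the robber on a shortest
path of `G` guards both ends of that path, so half as many cops as occupied vertices suffice.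
-/

namespace OuterKPlanar

open Set

/-! ### Chords of a circle -/

section Chords

/-- Twice the signed area of the triangle with the given corners: positive if the corners are in
counterclockwise order. -/
def signedArea (x y z : ℂ) : ℝ :=
  (y.re - x.re) * (z.im - x.im) - (z.re - x.re) * (y.im - x.im)

theorem openSegment_inter_openSegment_nonempty {a b c d : ℂ}
    (habc : 0 < signedArea a b c) (habd : 0 < signedArea a b d)
    (hacd : 0 < signedArea a c d) (hbcd : 0 < signedArea b c d) :
    (openSegment ℝ a c ∩ openSegment ℝ b d).Nonempty := by
  set A := signedArea b c d with hA
  set B := signedArea a c d with hB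
  set C := signedArea a b d with hC
  set D := signedArea a b c with hD
  -- Four points of the plane are affinely dependent: `A a + C c = B b + D d` and `A + C = B + D`.
  have sum_eq : A + C = B + D := by simp only [hA, hB, hC, hD, signedArea]; ring
  have re_eq : A * a.re + C * c.re = B * b.re + D * d.re := by
    simp only [hA, hB, hC, hD, signedArea]; ring
  have im_eq : A * a.im + C * c.im = B * b.im + D * d.im := by
    simp only [hA, hB, hC, hD, signedArea]; ring
  refine ⟨(A / (A + C)) • a + (C / (A + C)) • c,
    ⟨A / (A + C), C / (A + C), by positivity, by positivity, by field_simp, rfl⟩,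
    ⟨B / (B + D), D / (B + D), by positivity, by positivity, by field_simp, ?_⟩⟩
  rw [← sum_eq]
  apply Complex.ext
  · simp only [Complex.add_re, Complex.real_smul, Complex.re_ofReal_mul]
    field_simp
    linarith
  · simp only [Complex.add_im, Complex.real_smul, Complex.im_ofReal_mul]
    field_simp
    linarith

theorem sin_two_mul_add_sin_two_mul_sub_sin (x y : ℝ) :
    Real.sin (2 * x) + Real.sin (2 * y) - Real.sin (2 * (x + y)) =
      4 * Real.sin x * Real.sin y * Real.sin (x + y) := by
  rw [Real.sin_two_mul, Real.sin_two_mul, Real.sin_two_mul, Real.sin_add, Real.cos_add]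
  linear_combination (-2 * Real.sin y * Real.cos y) * Real.sin_sq_add_cos_sq x +
    (-2 * Real.sin x * Real.cos x) * Real.sin_sq_add_cos_sq y

theorem signedArea_circleMap (c : ℂ) (R θ α β : ℝ) :
    signedArea (circleMap c R θ) (circleMap c R (θ + 2 * α))
        (circleMap c R (θ + 2 * (α + β))) =
      4 * R ^ 2 * Real.sin α * Real.sin β * Real.sin (α + β) := by
  have h : signedArea (circleMap c R θ) (circleMap c R (θ + 2 * α))
      (circleMap c R (θ + 2 * (α + β))) =
      R ^ 2 * (Real.sin (2 * α) + Real.sin (2 * β) - Real.sin (2 * (α + β))) := by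
    have hα : 2 * α = (θ + 2 * α) - θ := by ring
    have hβ : 2 * β = (θ + 2 * (α + β)) - (θ + 2 * α) := by ring
    have hαβ : 2 * (α + β) = (θ + 2 * (α + β)) - θ := by ring
    rw [congrArg Real.sin hα, congrArg Real.sin hβ, congrArg Real.sin hαβ]
    simp only [signedArea, circleMap, Complex.add_re, Complex.add_im, Complex.re_ofReal_mul,
      Complex.im_ofReal_mul, Complex.exp_ofReal_mul_I_re, Complex.exp_ofReal_mul_I_im,
      Real.sin_sub]
    ring
  rw [h, sin_two_mul_add_sin_two_mul_sub_sin]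
  ring

theorem signedArea_circleMap_pos {c : ℂ} {R θ₁ θ₂ θ₃ : ℝ} (hR : 0 < R) (h₁₂ : θ₁ < θ₂)
    (h₂₃ : θ₂ < θ₃) (h₃₁ : θ₃ < θ₁ + 2 * Real.pi) :
    0 < signedArea (circleMap c R θ₁) (circleMap c R θ₂) (circleMap c R θ₃) := by
  obtain ⟨α, rfl⟩ : ∃ α, θ₂ = θ₁ + 2 * α := ⟨(θ₂ - θ₁) / 2, by ring⟩
  obtain ⟨β, rfl⟩ : ∃ β, θ₃ = θ₁ + 2 * (α + β) := ⟨(θ₃ - θ₁) / 2 - α, by ring⟩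
  have hα : 0 < Real.sin α := Real.sin_pos_of_pos_of_lt_pi (by linarith) (by linarith)
  have hβ : 0 < Real.sin β := Real.sin_pos_of_pos_of_lt_pi (by linarith) (by linarith)
  have hαβ : 0 < Real.sin (α + β) := Real.sin_pos_of_pos_of_lt_pi (by linarith) (by linarith)
  rw [signedArea_circleMap]
  positivity

namespace ConvexDrawing

variable {V : Type*} (D : ConvexDrawing V)

/-- The angle in `(-π, π]` at which a vertex is placed on the circle. -/
noncomputable def angle (v : V) : ℝ :=
  (D.pos v - D.center).arg

theorem circleMap_angle (v : V) : circleMap D.center D.radius (D.angle v) = D.pos v := by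
  have h := D.pos_mem v
  rw [mem_sphere_iff_norm] at h
  rw [circleMap, angle, ← h, Complex.norm_mul_exp_arg_mul_I, add_sub_cancel]

theorem angle_injective : Function.Injective D.angle := fun u v h =>
  D.pos_injective <| by rw [← D.circleMap_angle u, ← D.circleMap_angle v, h]

theorem openSegment_inter_openSegment_nonempty_of_angle_lt {a b c d : V}
    (hab : D.angle a < D.angle b) (hbc : D.angle b < D.angle c) (hcd : D.angle c < D.angle d) :
    (openSegment ℝ (D.pos a) (D.pos c) ∩ openSegment ℝ (D.pos b) (D.pos d)).Nonempty := by
  have hda : D.angle d < D.angle a + 2 * Real.pi := by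
    have hd : D.angle d ≤ Real.pi := Complex.arg_le_pi _
    have ha : -Real.pi < D.angle a := Complex.neg_pi_lt_arg _
    linarith
  simp only [← D.circleMap_angle]
  apply openSegment_inter_openSegment_nonempty <;>
    apply signedArea_circleMap_pos D.radius_pos <;> linarith

theorem crosses_of_angle_lt {a b c d : V} (hab : D.angle a < D.angle b)
    (hbc : D.angle b < D.angle c) (hcd : D.angle c < D.angle d) :
    D.Crosses s(a, c) s(b, d) := by
  refine ⟨fun h => ?_, a, c, b, d, rfl, rfl,
    D.openSegment_inter_openSegment_nonempty_of_angle_lt hab hbc hcd⟩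
  rcases Sym2.mem_iff.1 (h ▸ Sym2.mem_mk_left a c) with rfl | rfl
  · exact hab.false
  · exact (hab.trans (hbc.trans hcd)).false

theorem Crosses.symm {D : ConvexDrawing V} {e f : Sym2 V} (h : D.Crosses e f) :
    D.Crosses f e := by
  obtain ⟨hne, a, b, c, d, he, hf, hab⟩ := h
  exact ⟨hne.symm, c, d, a, b, hf, he, by rwa [inter_comm]⟩

end ConvexDrawing

end Chords

/-! ### Crossings of chords of a linearly ordered vertex set -/

theorem exists_crossover {α β : Type*} [LinearOrder α] [LinearOrder β] {s : Set α}
    (hs : s.Finite) (hne : s.Nonempty) {f g : α → β} (hf : MonotoneOn f s)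
    (hg : AntitoneOn g s) :
    ∃ l ∈ s, (∀ p ∈ s, p < l → f p ≤ g p) ∧ ∀ q ∈ s, l < q → g q ≤ f q := by
  rcases {p ∈ s | f p ≤ g p}.eq_empty_or_nonempty with hempty | hnonempty
  · obtain ⟨l, hl, hmin⟩ := hs.exists_minimal hne
    refine ⟨l, hl, fun p hp hpl => absurd (hmin hp hpl.le) hpl.not_ge, fun q hq _ => ?_⟩
    exact le_of_not_ge fun h => (hempty.subset ⟨hq, h⟩ :)
  · obtain ⟨l, ⟨hl, hfg⟩, hmax⟩ := (hs.subset (sep_subset s _)).exists_maximal hnonempty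
    refine ⟨l, hl, fun p hp hpl => ?_, fun q hq hlq => ?_⟩
    · exact (hf hp hl hpl.le).trans (hfg.trans (hg hp hl hpl.le))
    · exact le_of_not_ge fun h => hlq.not_ge (hmax ⟨hq, h⟩ hlq.le)

section Edges

variable {V : Type*} (G : SimpleGraph V)

/-- The edges of `G` from `S` to `T`, directed. -/
def edgesBetween (S T : Set V) : Set (V × V) :=
  {e | e.1 ∈ S ∧ e.2 ∈ T ∧ G.Adj e.1 e.2}

/-- The number of edges of `G` from `S` to `T`; an edge inside `S ∩ T` counts twice. -/
noncomputable def numEdges (S T : Set V) : ℕ := (edgesBetween G S T).ncard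

variable {G}

theorem mk_mem_edgesBetween {S T : Set V} {u v : V} :
    (u, v) ∈ edgesBetween G S T ↔ u ∈ S ∧ v ∈ T ∧ G.Adj u v := Iff.rfl

theorem numEdges_comm (S T : Set V) : numEdges G S T = numEdges G T S := by
  have : edgesBetween G T S = Prod.swap '' edgesBetween G S T := by
    ext ⟨u, v⟩
    simp only [image_swap_eq_preimage_swap, mem_preimage, Prod.swap_prod_mk, mk_mem_edgesBetween,
      G.adj_comm u v]
    tauto
  rw [numEdges, numEdges, this, ncard_image_of_injective _ Prod.swap_injective]

variable [Finite V]

theorem numEdges_le_add {S T S₁ T₁ S₂ T₂ : Set V}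
    (h : ∀ u ∈ S, ∀ v ∈ T, G.Adj u v → u ∈ S₁ ∧ v ∈ T₁ ∨ u ∈ S₂ ∧ v ∈ T₂) :
    numEdges G S T ≤ numEdges G S₁ T₁ + numEdges G S₂ T₂ := by
  refine (ncard_le_ncard (t := edgesBetween G S₁ T₁ ∪ edgesBetween G S₂ T₂) ?_).trans
    (ncard_union_le _ _)
  rintro ⟨u, v⟩ ⟨hu, hv, huv⟩
  exact (h u hu v hv huv).imp (fun h => ⟨h.1, h.2, huv⟩) (fun h => ⟨h.1, h.2, huv⟩)

theorem numEdges_le_numEdges {S T S' T' : Set V}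
    (h : ∀ u ∈ S, ∀ v ∈ T, G.Adj u v → u ∈ S' ∧ v ∈ T') :
    numEdges G S T ≤ numEdges G S' T' :=
  ncard_le_ncard fun e he => ⟨(h _ he.1 _ he.2.1 he.2.2).1, (h _ he.1 _ he.2.1 he.2.2).2, he.2.2⟩

theorem numEdges_mono_left {S S' : Set V} (T : Set V) (h : S ⊆ S') :
    numEdges G S T ≤ numEdges G S' T :=
  numEdges_le_numEdges fun _ hu _ hv _ => ⟨h hu, hv⟩

theorem numEdges_mono_right (S : Set V) {T T' : Set V} (h : T ⊆ T') :
    numEdges G S T ≤ numEdges G S T' :=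
  numEdges_le_numEdges fun _ hu _ hv _ => ⟨hu, h hv⟩

theorem numEdges_union_left_add_numEdges_inter_left (S S' T : Set V) :
    numEdges G (S ∪ S') T + numEdges G (S ∩ S') T = numEdges G S T + numEdges G S' T := by
  have union : edgesBetween G (S ∪ S') T = edgesBetween G S T ∪ edgesBetween G S' T := by
    ext ⟨u, v⟩
    simp only [mem_union, mk_mem_edgesBetween, or_and_right]
  have inter : edgesBetween G (S ∩ S') T = edgesBetween G S T ∩ edgesBetween G S' T := by
    ext ⟨u, v⟩
    simp only [mem_inter_iff, mk_mem_edgesBetween]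
    tauto
  rw [numEdges, numEdges, numEdges, numEdges, union, inter, ncard_union_add_ncard_inter]

theorem numEdges_union_right_of_disjoint (S : Set V) {T T' : Set V} (h : Disjoint T T') :
    numEdges G S (T ∪ T') = numEdges G S T + numEdges G S T' := by
  have empty : numEdges G ∅ S = 0 := by simp [numEdges, edgesBetween]
  rw [numEdges_comm, numEdges_comm S T, numEdges_comm S T',
    ← numEdges_union_left_add_numEdges_inter_left, h.inter_eq, empty, add_zero]

end Edges

section Crossings

variable {V : Type*} {G : SimpleGraph V} [LinearOrder V]

variable (G) in
/-- The number of edges of `G` that cross the chord with ends `i < j`, if the vertices lie in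
increasing order on a circle. -/
noncomputable def crossNum (i j : V) : ℕ := numEdges G (Ioo i j) (Icc i j)ᶜ

variable [Finite V]

theorem crossNum_left_le_add (i l j : V) :
    crossNum G i l ≤ numEdges G (Ioo i l) (Ioc l j) + numEdges G (Ioo i l) (Icc i j)ᶜ := by
  refine numEdges_le_add fun u hu v hv _ => ?_
  simp only [mem_Ioo, mem_Ioc, mem_compl_iff, mem_Icc] at *
  grind

theorem crossNum_right_le_add (i l j : V) :
    crossNum G l j ≤ numEdges G (Ioo l j) (Ico i l) + numEdges G (Ioo l j) (Icc i j)ᶜ := by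
  refine numEdges_le_add fun u hu v hv _ => ?_
  simp only [mem_Ioo, mem_Ico, mem_compl_iff, mem_Icc] at *
  grind

/-- An edge `pq` of `G` with ends in `[i, j]`, other than `ij`, such that no other edge with ends in
`[i, j]`, except possibly `ij`, passes over it. -/
structure IsMaximalArc (G : SimpleGraph V) (i j p q : V) : Prop where
  le_left : i ≤ p
  lt : p < q
  le_right : q ≤ j
  ne : i < p ∨ q < j
  adj : G.Adj p q
  eq_or_eq : ∀ u v, i ≤ u → u ≤ p → q ≤ v → v ≤ j → G.Adj u v → u = p ∧ v = q ∨ u = i ∧ v = j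

theorem exists_isMaximalArc {i j l u v : V} (hiu : i ≤ u) (hul : u < l) (hlv : l < v)
    (hvj : v ≤ j) (huv : G.Adj u v) (hne : i < u ∨ v < j) :
    ∃ p q, p < l ∧ l < q ∧ IsMaximalArc G i j p q := by
  let arcs : Set (V × V) :=
    {e | i ≤ e.1 ∧ e.1 < l ∧ l < e.2 ∧ e.2 ≤ j ∧ G.Adj e.1 e.2 ∧ (i < e.1 ∨ e.2 < j)}
  obtain ⟨⟨p, q⟩, ⟨hip, hpl, hlq, hqj, hpq, hne'⟩, hmax⟩ :=
    (toFinite arcs).exists_maximalFor (fun e => (OrderDual.toDual e.1, e.2)) arcs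
      ⟨(u, v), hiu, hul, hlv, hvj, huv, hne⟩
  refine ⟨p, q, hpl, hlq, hip, hpl.trans hlq, hqj, hne', hpq, fun a b hia hap hqb hbj hab => ?_⟩
  by_cases hab' : i < a ∨ b < j
  · have hle := hmax (j := (a, b))
      ⟨hia, hap.trans_lt hpl, hlq.trans_le hqb, hbj, hab, hab'⟩ ⟨hap, hqb⟩
    exact .inl ⟨hap.antisymm hle.1, hle.2.antisymm hqb⟩
  · rw [not_or, not_lt, not_lt] at hab'
    exact .inr ⟨hab'.1.antisymm hia, hbj.antisymm hab'.2⟩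

namespace IsMaximalArc

variable {i j p q : V} (h : IsMaximalArc G i j p q)
include h

theorem crossNum_left_fst_le :
    crossNum G i p ≤ numEdges G (Ioo p q) (Ico i p) + numEdges G (Ioo i p) (Icc i j)ᶜ := by
  refine (crossNum_left_le_add i p j).trans (Nat.add_le_add_right ?_ _)
  rw [numEdges_comm]
  refine numEdges_le_numEdges fun v hv u hu huv => ⟨⟨hv.1, ?_⟩, hu.1.le, hu.2⟩
  by_contra! hqv
  rcases h.eq_or_eq u v hu.1.le hu.2.le hqv hv.2 huv.symm with ⟨rfl, rfl⟩ | ⟨rfl, rfl⟩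
  exacts [hu.2.false, hu.1.false]

theorem crossNum_fst_right_le :
    crossNum G p j ≤ numEdges G (Ioo p q) (Ico i p) + numEdges G (Ioo p j) (Icc i j)ᶜ := by
  refine (crossNum_right_le_add i p j).trans (Nat.add_le_add_right ?_ _)
  refine numEdges_le_numEdges fun v hv u hu huv => ⟨⟨hv.1, ?_⟩, hu⟩
  by_contra! hqv
  rcases h.eq_or_eq u v hu.1 hu.2.le hqv hv.2.le huv.symm with ⟨rfl, rfl⟩ | ⟨rfl, rfl⟩
  exacts [hu.2.false, hv.2.false]

theorem crossNum_left_snd_le :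
    crossNum G i q ≤ numEdges G (Ioo p q) (Ioc q j) + numEdges G (Ioo i q) (Icc i j)ᶜ := by
  refine (crossNum_left_le_add i q j).trans (Nat.add_le_add_right ?_ _)
  refine numEdges_le_numEdges fun u hu v hv huv => ⟨⟨?_, hu.2⟩, hv⟩
  by_contra! hup
  rcases h.eq_or_eq u v hu.1.le hup hv.1.le hv.2 huv with ⟨rfl, rfl⟩ | ⟨rfl, rfl⟩
  exacts [hv.1.false, hu.1.false]

theorem crossNum_snd_right_le :
    crossNum G q j ≤ numEdges G (Ioo p q) (Ioc q j) + numEdges G (Ioo q j) (Icc i j)ᶜ := by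
  refine (crossNum_right_le_add i q j).trans (Nat.add_le_add_right ?_ _)
  rw [numEdges_comm]
  refine numEdges_le_numEdges fun u hu v hv huv => ⟨⟨?_, hu.2⟩, hv.1, hv.2.le⟩
  by_contra! hup
  rcases h.eq_or_eq u v hu.1 hup hv.1.le hv.2.le huv with ⟨rfl, rfl⟩ | ⟨rfl, rfl⟩
  exacts [hv.1.false, hv.2.false]

theorem add_add_le_crossNum :
    numEdges G (Ioo p q) (Ico i p) + numEdges G (Ioo p q) (Ioc q j) +
      numEdges G (Ioo p q) (Icc i j)ᶜ ≤ crossNum G p q := by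
  have hlr : Disjoint (Ico i p) (Ioc q j) := disjoint_left.2 fun x hx hx' =>
    (hx.2.trans (h.lt.trans hx'.1)).false
  have hlro : Disjoint (Ico i p ∪ Ioc q j) (Icc i j)ᶜ := by
    refine disjoint_left.2 fun x hx hx' => hx' ?_
    rcases hx with hx | hx
    · exact ⟨hx.1, hx.2.le.trans (h.lt.le.trans h.le_right)⟩
    · exact ⟨h.le_left.trans (h.lt.le.trans hx.1.le), hx.2⟩
  rw [← numEdges_union_right_of_disjoint _ hlr, ← numEdges_union_right_of_disjoint _ hlro]
  refine numEdges_mono_right _ (union_subset (union_subset ?_ ?_) ?_)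
  · exact fun x hx hx' => hx.2.not_ge hx'.1
  · exact fun x hx hx' => hx.1.not_ge hx'.2
  · exact compl_subset_compl.2 (Icc_subset_Icc h.le_left h.le_right)

theorem numEdges_add_numEdges_le (O : Set V) :
    numEdges G (Ioo p j) O + numEdges G (Ioo i q) O ≤
      numEdges G (Ioo i j) O + numEdges G (Ioo p q) O := by
  rw [← numEdges_union_left_add_numEdges_inter_left, Ioo_inter_Ioo, sup_eq_left.2 h.le_left,
    inf_eq_right.2 h.le_right]
  gcongr
  exact numEdges_mono_left _ (union_subset (Ioo_subset_Ioo_left h.le_left)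
    (Ioo_subset_Ioo_right h.le_right))

theorem crossNum_le_or_crossNum_le {k : ℕ} (hij : crossNum G i j ≤ k) (hpq : crossNum G p q ≤ k)
    (hp : i < p → numEdges G (Ioo i p) (Icc i j)ᶜ ≤ numEdges G (Ioo p j) (Icc i j)ᶜ)
    (hq : q < j → numEdges G (Ioo q j) (Icc i j)ᶜ ≤ numEdges G (Ioo i q) (Icc i j)ᶜ) :
    i < p ∧ crossNum G i p ≤ k ∧ crossNum G p j ≤ k ∨
      q < j ∧ crossNum G i q ≤ k ∧ crossNum G q j ≤ k := by
  have hip_le := h.crossNum_left_fst_le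
  have hpj_le := h.crossNum_fst_right_le
  have hiq_le := h.crossNum_left_snd_le
  have hqj_le := h.crossNum_snd_right_le
  have hpq_ge := h.add_add_le_crossNum
  have hij_ge := h.numEdges_add_numEdges_le (Icc i j)ᶜ
  rw [crossNum] at hij
  rcases h.le_left.eq_or_lt with rfl | hip
  · have hqj := h.ne.resolve_left (lt_irrefl _)
    have := hq hqj
    exact .inr ⟨hqj, by omega, by omega⟩
  rcases h.le_right.eq_or_lt with rfl | hqj
  · have := hp hip
    exact .inl ⟨hip, by omega, by omega⟩
  -- The bounds on the chords at `p` and on those at `q` add up to at most `2 * k`.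
  have := hp hip
  have := hq hqj
  rcases le_or_gt (numEdges G (Ioo p q) (Ico i p) + numEdges G (Ioo p j) (Icc i j)ᶜ) k
    with hle | hgt
  · exact .inl ⟨hip, by omega, by omega⟩
  · exact .inr ⟨hqj, by omega, by omega⟩

end IsMaximalArc

theorem exists_split {k : ℕ} (hG : ∀ u v, u < v → G.Adj u v → crossNum G u v ≤ k) {i j : V}
    (hij : crossNum G i j ≤ k) (hne : (Ioo i j).Nonempty) :
    ∃ l ∈ Ioo i j, crossNum G i l ≤ k ∧ crossNum G l j ≤ k := by
  obtain ⟨l, hl, hleft, hright⟩ := exists_crossover (toFinite _) hne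
    (f := fun l => numEdges G (Ioo i l) (Icc i j)ᶜ) (g := fun l => numEdges G (Ioo l j) (Icc i j)ᶜ)
    (fun _ _ _ _ h => numEdges_mono_left _ (Ioo_subset_Ioo_right h))
    (fun _ _ _ _ h => numEdges_mono_left _ (Ioo_subset_Ioo_left h))
  by_cases harc : ∃ u v, i ≤ u ∧ u < l ∧ l < v ∧ v ≤ j ∧ G.Adj u v ∧ (i < u ∨ v < j)
  · obtain ⟨u, v, hiu, hul, hlv, hvj, huv, hne'⟩ := harc
    obtain ⟨p, q, hpl, hlq, hmax⟩ := exists_isMaximalArc hiu hul hlv hvj huv hne'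
    rcases hmax.crossNum_le_or_crossNum_le hij (hG p q hmax.lt hmax.adj)
      (fun hip => hleft p ⟨hip, hpl.trans hl.2⟩ hpl)
      (fun hqj => hright q ⟨hl.1.trans hlq, hqj⟩ hlq) with ⟨hip, hp⟩ | ⟨hqj, hq⟩
    · exact ⟨p, ⟨hip, hpl.trans hl.2⟩, hp⟩
    · exact ⟨q, ⟨hl.1.trans hlq, hqj⟩, hq⟩
  · push Not at harc
    -- No edge passes over `l`, so the edges crossing `il` or `lj` also cross `ij`.
    refine ⟨l, hl, le_trans ?_ hij, le_trans ?_ hij⟩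
    · refine numEdges_le_numEdges fun u hu v hv huv => ⟨⟨hu.1, hu.2.trans hl.2⟩, fun hv' => ?_⟩
      have hlv : l < v := not_le.1 fun h => hv ⟨hv'.1, h⟩
      exact (harc u v hu.1.le hu.2 hlv hv'.2 huv).1.not_gt hu.1
    · refine numEdges_le_numEdges fun u hu v hv huv => ⟨⟨hl.1.trans hu.1, hu.2⟩, fun hv' => ?_⟩
      have hvl : v < l := not_le.1 fun h => hv ⟨h, hv'.2⟩
      exact (harc v u hv'.1 hvl hu.1 hu.2.le huv.symm).2.not_gt hu.2

end Crossings

/-! ### Sweeping a graph -/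

section Sweep

variable {V : Type*}

/-- `Sweep G s X C` says that searchers who stand on `X`, which separates the territory `C` from the
rest of `G`, can clear `C` without ever moving to more than `s` vertices. They treat mutually
non-adjacent parts of `C` separately, leave vertices without neighbours in `C`, and advance to
vertices of `C`. -/
inductive Sweep (G : SimpleGraph V) (s : ℕ) : Set V → Set V → Prop
  | nil (X : Set V) : Sweep G s X ∅
  | join {X C₁ C₂ : Set V} (hC : Disjoint C₁ C₂) (hadj : ∀ u ∈ C₁, ∀ v ∈ C₂, ¬ G.Adj u v)
      (h₁ : Sweep G s X C₁) (h₂ : Sweep G s X C₂) : Sweep G s X (C₁ ∪ C₂)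
  | forget {X X' C : Set V} (hX : X' ⊆ X) (hadj : ∀ x ∈ X, x ∉ X' → ∀ y ∈ C, ¬ G.Adj x y)
      (h : Sweep G s X' C) : Sweep G s X C
  | place {X C : Set V} (w : V) (hw : w ∈ C) (hs : X.ncard + 1 ≤ s)
      (h : Sweep G s (insert w X) (C \ {w})) : Sweep G s X C

/-- `X` separates `C` from the other vertices: the neighbours of `C` lie in `C` or in `X`. -/
def Encloses (G : SimpleGraph V) (X C : Set V) : Prop :=
  ∀ u ∈ C, ∀ v, G.Adj u v → v ∈ C ∨ v ∈ X

namespace Encloses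

variable {G : SimpleGraph V} {X X' C C₁ C₂ : Set V}

theorem univ (G : SimpleGraph V) (X : Set V) : Encloses G X univ :=
  fun _ _ v _ => .inl (mem_univ v)

theorem left (h : Encloses G X (C₁ ∪ C₂)) (hadj : ∀ u ∈ C₁, ∀ v ∈ C₂, ¬ G.Adj u v) :
    Encloses G X C₁ := fun u hu v huv =>
  (h u (.inl hu) v huv).imp_left fun hv => hv.resolve_right fun hv => hadj u hu v hv huv

theorem right (h : Encloses G X (C₁ ∪ C₂)) (hadj : ∀ u ∈ C₁, ∀ v ∈ C₂, ¬ G.Adj u v) :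
    Encloses G X C₂ := fun u hu v huv =>
  (h u (.inr hu) v huv).imp_left fun hv => hv.resolve_left fun hv => hadj v hv u hu huv.symm

theorem of_forall_not_adj (h : Encloses G X C)
    (hadj : ∀ x ∈ X, x ∉ X' → ∀ y ∈ C, ¬ G.Adj x y) : Encloses G X' C :=
  fun u hu v huv => (h u hu v huv).imp_right fun hv => by
    by_contra hv'
    exact hadj v hv hv' u hu huv.symm

theorem insert_sdiff_singleton (h : Encloses G X C) (w : V) :
    Encloses G (insert w X) (C \ {w}) := fun u hu v huv => by
  rcases eq_or_ne v w with rfl | hvw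
  · exact .inr (.inl rfl)
  · exact (h u hu.1 v huv).imp (fun hv => ⟨hv, hvw⟩) .inr

end Encloses

/-- The vertices of `S` that have a neighbour in `T`. -/
def attachment (G : SimpleGraph V) (S T : Set V) : Set V :=
  {u ∈ S | ∃ v ∈ T, G.Adj u v}

variable {G : SimpleGraph V} {s k : ℕ}

theorem ncard_attachment_le [Finite V] (S T : Set V) :
    (attachment G S T).ncard ≤ numEdges G S T := by
  refine (ncard_le_ncard (t := Prod.fst '' edgesBetween G S T) ?_).trans
    (ncard_image_le (toFinite _))
  rintro u ⟨hu, v, hv, huv⟩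
  exact ⟨(u, v), ⟨hu, hv, huv⟩, rfl⟩

theorem ncard_union_attachment_sdiff_le [Finite V] {A D O : Set V} (hA : A ⊆ attachment G D O) :
    (A ∪ attachment G O (D \ A)).ncard ≤ numEdges G D O := by
  have hAD : A ⊆ D := fun u hu => (hA hu).1
  calc (A ∪ attachment G O (D \ A)).ncard
      ≤ (attachment G A O).ncard + (attachment G O (D \ A)).ncard := by
        refine (ncard_union_le _ _).trans (Nat.add_le_add_right (ncard_le_ncard ?_) _)
        exact fun u hu => ⟨hu, (hA hu).2⟩
    _ ≤ numEdges G O A + numEdges G O (D \ A) := by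
        rw [numEdges_comm O A]
        exact Nat.add_le_add (ncard_attachment_le _ _) (ncard_attachment_le _ _)
    _ = numEdges G D O := by
        rw [← numEdges_union_right_of_disjoint _ disjoint_sdiff_right, union_sdiff_cancel hAD,
          numEdges_comm]

namespace Sweep

variable [Finite V]

theorem of_subset_union {X C Z : Set V} (hXC : Disjoint X C) (hXZ : X ⊆ Z) (hZ : Z ⊆ X ∪ C)
    (hs : Z.ncard ≤ s) (h : Sweep G s Z (C \ Z)) : Sweep G s X C := by
  induction X using WellFoundedGT.induction generalizing C with
  | ind X ih =>
  rcases hXZ.eq_or_ssubset with rfl | hssub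
  · rwa [hXC.symm.sdiff_eq_left] at h
  obtain ⟨w, hwZ, hwX⟩ := exists_of_ssubset hssub
  have hwC : w ∈ C := (hZ hwZ).resolve_left hwX
  refine .place w hwC ((Nat.succ_le_of_lt (ncard_lt_ncard hssub)).trans hs)
    (ih _ (ssubset_insert hwX) ?_ (insert_subset hwZ hXZ) ?_ ?_)
  · exact disjoint_insert_left.2 ⟨fun h => h.2 rfl, hXC.mono_right sdiff_subset⟩
  · rwa [insert_union, ← union_insert, insert_sdiff_singleton, insert_eq_of_mem hwC]
  · rwa [sdiff_sdiff, union_eq_self_of_subset_left (singleton_subset_iff.2 hwZ)]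

theorem of_insert_attachment {A B D O : Set V} {u : V} (hu : u ∈ attachment G D O)
    (hA : A ⊆ attachment G D O) (huA : u ∉ A) (hs : B.ncard + numEdges G D O + 1 ≤ s)
    (h : Sweep G s (B ∪ (insert u A ∪ attachment G O (D \ insert u A))) (D \ insert u A)) :
    Sweep G s (B ∪ (A ∪ attachment G O (D \ A))) (D \ A) := by
  refine .place u ⟨hu.1, huA⟩ ?_ ?_
  · have := ncard_union_attachment_sdiff_le hA
    have := ncard_union_le B (A ∪ attachment G O (D \ A))
    omega
  rw [sdiff_sdiff, union_singleton]
  refine .forget ?_ ?_ h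
  · refine union_subset (subset_union_left.trans (subset_insert _ _)) (union_subset ?_ ?_)
    · exact insert_subset_insert (subset_union_left.trans subset_union_right)
    · rintro x ⟨hx, v, hv, hxv⟩
      exact .inr (.inr (.inr ⟨hx, v, ⟨hv.1, fun h => hv.2 (.inr h)⟩, hxv⟩))
  · rintro x hx hx' y hy hxy
    rcases hx with rfl | hx | hx | hx
    exacts [hx' (.inr (.inl (.inl rfl))), hx' (.inl hx), hx' (.inr (.inl (.inr hx))),
      hx' (.inr (.inr ⟨hx.1, y, hy, hxy⟩))]

theorem of_subset_attachment {A B D O : Set V} (hA : A ⊆ attachment G D O)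
    (hs : B.ncard + numEdges G D O + 1 ≤ s)
    (h : Sweep G s (B ∪ attachment G D O) (D \ attachment G D O)) :
    Sweep G s (B ∪ (A ∪ attachment G O (D \ A))) (D \ A) := by
  induction A using WellFoundedGT.induction with
  | ind A ih =>
  rcases hA.eq_or_ssubset with rfl | hssub
  · have : attachment G O (D \ attachment G D O) = ∅ :=
      eq_empty_of_forall_notMem fun v ⟨hv, u, hu, huv⟩ => hu.2 ⟨hu.1, v, hv, huv.symm⟩
    rwa [this, union_empty]
  · obtain ⟨u, hu, huA⟩ := exists_of_ssubset hssub
    exact of_insert_attachment hu hA huA hs (ih _ (ssubset_insert huA) (insert_subset hu hA))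

theorem of_cover {B D O Y : Set V} (hD : ∀ u ∈ D, ∀ v, G.Adj u v → v ∈ D ∪ B ∪ O) (hBY : B ⊆ Y)
    (hcov : ∀ u ∈ D, ∀ v ∈ O, G.Adj u v → u ∈ Y ∨ v ∈ Y) (hYD : Y ∩ D ⊆ attachment G D O)
    (hs : B.ncard + numEdges G D O + 1 ≤ s)
    (h : Sweep G s (B ∪ attachment G D O) (D \ attachment G D O)) : Sweep G s Y (D \ Y) := by
  have hsweep := of_subset_attachment hYD hs h
  rw [sdiff_inter_self_eq_sdiff] at hsweep
  refine .forget (union_subset hBY (union_subset inter_subset_left ?_)) ?_ hsweep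
  · rintro v ⟨hv, u, hu, hvu⟩
    exact (hcov u hu.1 v hv hvu.symm).resolve_left hu.2
  · intro x hx hx' y hy hxy
    rcases hD y hy.1 x hxy.symm with (hxD | hxB) | hxO
    exacts [hx' (.inr (.inl ⟨hx, hxD⟩)), hx' (.inl hxB), hx' (.inr (.inr ⟨hxO, y, hy, hxy⟩))]

end Sweep

section Chord

variable [LinearOrder V]

/-- `Y` separates the vertices between `i` and `j` from the others, and does so tightly: it contains
`i`, `j` and an end of each edge that crosses the chord `ij`, but no further vertex between `i` and
`j`. -/
structure GuardsChord (G : SimpleGraph V) (i j : V) (Y : Set V) : Prop where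
  left_mem : i ∈ Y
  right_mem : j ∈ Y
  mem_or_mem : ∀ u ∈ Ioo i j, ∀ v ∈ (Icc i j)ᶜ, G.Adj u v → u ∈ Y ∨ v ∈ Y
  inter_subset : Y ∩ Ioo i j ⊆ attachment G (Ioo i j) (Icc i j)ᶜ

theorem GuardsChord.sweep [Finite V] {i j : V} {Y : Set V} (hY : GuardsChord G i j Y)
    (hs : crossNum G i j + 3 ≤ s)
    (h : Sweep G s ({i, j} ∪ attachment G (Ioo i j) (Icc i j)ᶜ)
      (Ioo i j \ attachment G (Ioo i j) (Icc i j)ᶜ)) :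
    Sweep G s Y (Ioo i j \ Y) := by
  refine h.of_cover (fun u hu v _ => ?_) (insert_subset hY.left_mem
    (singleton_subset_iff.2 hY.right_mem)) hY.mem_or_mem hY.inter_subset ?_
  · rw [Ioo_union_both (hu.1.trans hu.2).le, union_compl_self]
    exact mem_univ v
  · have := ncard_insert_le i {j}
    rw [ncard_singleton] at this
    rw [crossNum] at hs
    omega

variable (G) in
/-- The bag of the triangle `ilj` in the sweep: its corners and one end of each edge that crosses
two of its sides. -/
def triangleBag (i l j : V) : Set V :=
  {i, j, l} ∪ attachment G (Ioo i j) (Icc i j)ᶜ ∪ attachment G (Ioo i l) (Ioo l j)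

section TriangleBag

variable {i l j : V}

theorem triangleBag_subset :
    triangleBag G i l j ⊆ {i, j, l} ∪ (attachment G (Ioo i l) (Ioo l j) ∪
      (attachment G (Ioo i l) (Icc i j)ᶜ ∪ attachment G (Ioo l j) (Icc i j)ᶜ)) := by
  rintro x ((hx | ⟨hx, hxO⟩) | hx)
  · exact .inl hx
  · rcases lt_trichotomy x l with h | h | h
    · exact .inr (.inr (.inl ⟨⟨hx.1, h⟩, hxO⟩))
    · exact .inl (.inr (.inr h))
    · exact .inr (.inr (.inr ⟨⟨h, hx.2⟩, hxO⟩))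
  · exact .inr (.inl hx)

variable (hl : l ∈ Ioo i j)
include hl

theorem numEdges_left_add_le_crossNum [Finite V] :
    numEdges G (Ioo i l) (Ioo l j) + numEdges G (Ioo i l) (Icc i j)ᶜ ≤ crossNum G i l := by
  have hdisj : Disjoint (Ioo l j) (Icc i j)ᶜ := disjoint_compl_right_iff_subset.2
    (Ioo_subset_Icc_self.trans (Icc_subset_Icc_left hl.1.le))
  rw [← numEdges_union_right_of_disjoint _ hdisj]
  exact numEdges_mono_right _ (union_subset (fun x hx hx' => hx.1.not_ge hx'.2)
    (compl_subset_compl.2 (Icc_subset_Icc_right hl.2.le)))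

theorem numEdges_right_add_le_crossNum [Finite V] :
    numEdges G (Ioo i l) (Ioo l j) + numEdges G (Ioo l j) (Icc i j)ᶜ ≤ crossNum G l j := by
  have hdisj : Disjoint (Ioo i l) (Icc i j)ᶜ := disjoint_compl_right_iff_subset.2
    (Ioo_subset_Icc_self.trans (Icc_subset_Icc_right hl.2.le))
  rw [numEdges_comm, ← numEdges_union_right_of_disjoint _ hdisj]
  exact numEdges_mono_right _ (union_subset (fun x hx hx' => hx.2.not_ge hx'.1)
    (compl_subset_compl.2 (Icc_subset_Icc_left hl.1.le)))

theorem numEdges_add_numEdges_le_crossNum [Finite V] :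
    numEdges G (Ioo i l) (Icc i j)ᶜ + numEdges G (Ioo l j) (Icc i j)ᶜ ≤ crossNum G i j := by
  have hdisj : Disjoint (Ioo i l) (Ioo l j) :=
    disjoint_left.2 fun x hx hx' => (hx.2.trans hx'.1).false
  rw [numEdges_comm, numEdges_comm (Ioo l j), ← numEdges_union_right_of_disjoint _ hdisj,
    numEdges_comm]
  exact numEdges_mono_left _ (union_subset (Ioo_subset_Ioo_right hl.2.le)
    (Ioo_subset_Ioo_left hl.1.le))

theorem two_mul_ncard_triangleBag_le [Finite V] :
    2 * (triangleBag G i l j).ncard ≤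
      crossNum G i l + crossNum G l j + crossNum G i j + 6 := by
  have hbag := (ncard_le_ncard (triangleBag_subset (G := G) (i := i) (l := l) (j := j))).trans
    (ncard_union_le _ _)
  have hunion := ncard_union_le (attachment G (Ioo i l) (Ioo l j))
    (attachment G (Ioo i l) (Icc i j)ᶜ ∪ attachment G (Ioo l j) (Icc i j)ᶜ)
  have hunion' := ncard_union_le (attachment G (Ioo i l) (Icc i j)ᶜ)
    (attachment G (Ioo l j) (Icc i j)ᶜ)
  have hcorners : ({i, j, l} : Set V).ncard ≤ 3 :=
    (ncard_insert_le _ _).trans (Nat.succ_le_succ (by simpa using ncard_insert_le j {l}))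
  have := ncard_attachment_le (G := G) (Ioo i l) (Ioo l j)
  have := ncard_attachment_le (G := G) (Ioo i l) (Icc i j)ᶜ
  have := ncard_attachment_le (G := G) (Ioo l j) (Icc i j)ᶜ
  have := numEdges_left_add_le_crossNum (G := G) hl
  have := numEdges_right_add_le_crossNum (G := G) hl
  have := numEdges_add_numEdges_le_crossNum (G := G) hl
  omega

theorem guardsChord_triangleBag_left : GuardsChord G i l (triangleBag G i l j) where
  left_mem := .inl (.inl (.inl rfl))
  right_mem := .inl (.inl (.inr (.inr rfl)))
  mem_or_mem u hu v hv huv := by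
    by_cases hvij : v ∈ Icc i j
    · have hlv : l < v := not_le.1 fun h => hv ⟨hvij.1, h⟩
      rcases hvij.2.eq_or_lt with rfl | hvj
      · exact .inr (.inl (.inl (.inr (.inl rfl))))
      · exact .inl (.inr ⟨hu, v, ⟨hlv, hvj⟩, huv⟩)
    · exact .inl (.inl (.inr ⟨⟨hu.1, hu.2.trans hl.2⟩, v, hvij, huv⟩))
  inter_subset := by
    rintro u ⟨((rfl | rfl | rfl) | ⟨-, v, hv, huv⟩) | ⟨-, v, hv, huv⟩, hu⟩
    · exact (hu.1.false).elim
    · exact (hu.2.trans hl.2).false.elim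
    · exact hu.2.false.elim
    · exact ⟨hu, v, fun h => hv ⟨h.1, h.2.trans hl.2.le⟩, huv⟩
    · exact ⟨hu, v, fun h => h.2.not_gt hv.1, huv⟩

theorem guardsChord_triangleBag_right : GuardsChord G l j (triangleBag G i l j) where
  left_mem := .inl (.inl (.inr (.inr rfl)))
  right_mem := .inl (.inl (.inr (.inl rfl)))
  mem_or_mem u hu v hv huv := by
    by_cases hvij : v ∈ Icc i j
    · have hvl : v < l := not_le.1 fun h => hv ⟨h, hvij.2⟩
      rcases hvij.1.eq_or_lt with rfl | hiv
      · exact .inr (.inl (.inl (.inl rfl)))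
      · exact .inr (.inr ⟨⟨hiv, hvl⟩, u, hu, huv.symm⟩)
    · exact .inl (.inl (.inr ⟨⟨hl.1.trans hu.1, hu.2⟩, v, hvij, huv⟩))
  inter_subset := by
    rintro u ⟨((rfl | rfl | rfl) | ⟨-, v, hv, huv⟩) | ⟨hul, -⟩, hu⟩
    · exact (hl.1.trans hu.1).false.elim
    · exact hu.2.false.elim
    · exact hu.1.false.elim
    · exact ⟨hu, v, fun h => hv ⟨hl.1.le.trans h.1, h.2⟩, huv⟩
    · exact (hul.2.trans hu.1).false.elim

theorem sweep_triangleBag (h₁ : Sweep G s (triangleBag G i l j) (Ioo i l \ triangleBag G i l j))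
    (h₂ : Sweep G s (triangleBag G i l j) (Ioo l j \ triangleBag G i l j)) :
    Sweep G s (triangleBag G i l j) (Ioo i j \ triangleBag G i l j) := by
  have hl_mem : l ∈ triangleBag G i l j := .inl (.inl (.inr (.inr rfl)))
  rw [← Ioo_union_Ico_eq_Ioo hl.1 hl.2.le, ← Ioo_insert_left hl.2, union_insert,
    insert_sdiff_of_mem _ hl_mem, union_sdiff_distrib]
  refine .join (disjoint_left.2 fun x hx hx' => (hx.1.2.trans hx'.1.1).false) ?_ h₁ h₂
  exact fun u hu v hv huv => hu.2 (.inr ⟨hu.1, v, hv.1, huv⟩)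

theorem sweep_attachment_of_triangleBag [Finite V] (hs : (triangleBag G i l j).ncard ≤ s)
    (h : Sweep G s (triangleBag G i l j) (Ioo i j \ triangleBag G i l j)) :
    Sweep G s ({i, j} ∪ attachment G (Ioo i j) (Icc i j)ᶜ)
      (Ioo i j \ attachment G (Ioo i j) (Icc i j)ᶜ) := by
  have hsub : {i, j} ∪ attachment G (Ioo i j) (Icc i j)ᶜ ⊆ triangleBag G i l j := by
    rintro x ((rfl | rfl) | hx)
    exacts [.inl (.inl (.inl rfl)), .inl (.inl (.inr (.inl rfl))), .inl (.inr hx)]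
  refine .of_subset_union (Z := triangleBag G i l j) ?_ hsub ?_ hs ?_
  · refine disjoint_left.2 ?_
    rintro x ((rfl | rfl) | hx) ⟨hx', hxA⟩
    exacts [hx'.1.false, hx'.2.false, hxA hx]
  · rw [union_assoc, union_sdiff_self, ← union_assoc]
    rintro x (((rfl | rfl | rfl) | hx) | hx)
    exacts [.inl (.inl (.inl rfl)), .inl (.inl (.inr rfl)), .inr hl, .inl (.inr hx),
      .inr ⟨hx.1.1, hx.1.2.trans hl.2⟩]
  · rwa [sdiff_sdiff, union_eq_self_of_subset_left (subset_union_right.trans hsub)]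

end TriangleBag

theorem sweep_chord [Finite V] (hG : ∀ u v, u < v → G.Adj u v → crossNum G u v ≤ k) {i j : V}
    {Y : Set V} (hij : crossNum G i j ≤ k) (hY : GuardsChord G i j Y) :
    Sweep G (3 * k / 2 + 3) Y (Ioo i j \ Y) := by
  induction hn : (Ioo i j).ncard using Nat.strong_induction_on generalizing i j Y with
  | _ n ih =>
  rcases (Ioo i j).eq_empty_or_nonempty with hempty | hne
  · rw [hempty, empty_sdiff]
    exact .nil _
  obtain ⟨l, hl, hil, hlj⟩ := exists_split hG hij hne
  subst hn
  have hleft := ih _ (ncard_lt_ncard ⟨Ioo_subset_Ioo_right hl.2.le, fun h => (h hl).2.false⟩)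
    hil (guardsChord_triangleBag_left hl) rfl
  have hright := ih _ (ncard_lt_ncard ⟨Ioo_subset_Ioo_left hl.1.le, fun h => (h hl).1.false⟩)
    hlj (guardsChord_triangleBag_right hl) rfl
  have hbag := two_mul_ncard_triangleBag_le (G := G) hl
  exact hY.sweep (by omega)
    (sweep_attachment_of_triangleBag hl (by omega) (sweep_triangleBag hl hleft hright))

theorem sweep_univ [Finite V] (hG : ∀ u v, u < v → G.Adj u v → crossNum G u v ≤ k) :
    Sweep G (3 * k / 2 + 3) ∅ univ := by
  have := Fintype.ofFinite V
  rcases isEmpty_or_nonempty V with _ | _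
  · rw [univ_eq_empty_iff.2 ‹_›]
    exact .nil _
  let _ := Fintype.toBoundedOrder V
  have hcross : crossNum G ⊥ ⊤ ≤ k := by simp [crossNum, numEdges, edgesBetween]
  have hguards : GuardsChord G (⊥ : V) ⊤ {⊥, ⊤} :=
    { left_mem := .inl rfl
      right_mem := .inr rfl
      mem_or_mem := by simp
      inter_subset := by
        rintro x ⟨rfl | rfl, hx⟩
        exacts [hx.1.false.elim, hx.2.false.elim] }
  have huniv : univ \ {⊥, ⊤} = Ioo (⊥ : V) ⊤ \ {⊥, ⊤} := by
    rw [← Icc_bot_top, ← Icc_sdiff_both, sdiff_sdiff, union_self]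
  refine .of_subset_union (Z := {⊥, ⊤}) (empty_disjoint _) (empty_subset _) (by simp)
    ((ncard_insert_le _ _).trans (by rw [ncard_singleton]; omega)) ?_
  rw [huniv]
  exact sweep_chord hG hcross hguards

end Chord

end Sweep

/-! ### Tree decompositions -/

section AttachLeaf

variable {ι : Type*}

/-- The graph that is obtained from `T` by attaching the new vertex `none` to the vertex `i₀`. -/
def attachLeaf (T : SimpleGraph ι) (i₀ : ι) : SimpleGraph (Option ι) :=
  T.map Function.Embedding.some ⊔ .edge (some i₀) none

variable {T : SimpleGraph ι} {i₀ : ι}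

theorem attachLeaf_adj_some_some {x y : ι} (h : T.Adj x y) :
    (attachLeaf T i₀).Adj (some x) (some y) :=
  .inl (SimpleGraph.map_adj_apply.2 h)

theorem attachLeaf_adj_some_none : (attachLeaf T i₀).Adj (some i₀) none := by
  simp [attachLeaf, SimpleGraph.edge_adj]

theorem connected_induce_attachLeaf {S : Set ι} {S' : Set (Option ι)}
    (hS : (T.induce S).Connected) (hsome : ∀ x, some x ∈ S' ↔ x ∈ S)
    (hnone : none ∈ S' → i₀ ∈ S) : ((attachLeaf T i₀).induce S').Connected := by
  let f : T.induce S →g (attachLeaf T i₀).induce S' :=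
    ⟨fun x => ⟨some x.1, (hsome _).2 x.2⟩, fun h => attachLeaf_adj_some_some h⟩
  obtain ⟨a⟩ := hS.nonempty
  rw [SimpleGraph.connected_iff_exists_forall_reachable]
  refine ⟨f a, ?_⟩
  rintro ⟨b | b, hb⟩
  · refine ((hS a ⟨i₀, hnone hb⟩).map f).trans (SimpleGraph.Adj.reachable ?_)
    exact attachLeaf_adj_some_none
  · exact (hS a ⟨b, (hsome _).1 hb⟩).map f

theorem connected_attachLeaf (hT : T.Connected) : (attachLeaf T i₀).Connected := by
  rw [SimpleGraph.connected_iff_exists_forall_reachable]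
  refine ⟨some i₀, ?_⟩
  rintro (_ | x)
  · exact attachLeaf_adj_some_none.reachable
  · exact (hT i₀ x).map (⟨some, attachLeaf_adj_some_some⟩ : T →g attachLeaf T i₀)

theorem card_edgeSet_attachLeaf [Finite ι] :
    Nat.card (attachLeaf T i₀).edgeSet = Nat.card T.edgeSet + 1 := by
  have hnew : s(some i₀, none) ∉ Function.Embedding.some.sym2Map '' T.edgeSet := by
    rintro ⟨e, -, he⟩
    obtain ⟨x, -, hx⟩ := Sym2.mem_map.1 (he ▸ Sym2.mem_mk_right (some i₀) none)
    cases hx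
  rw [Nat.card_coe_set_eq, Nat.card_coe_set_eq, attachLeaf, SimpleGraph.edgeSet_sup,
    SimpleGraph.edgeSet_edge_of_ne (Option.some_ne_none i₀), SimpleGraph.edgeSet_map,
    union_singleton, ncard_insert_of_notMem hnew,
    ncard_image_of_injective _ (Function.Embedding.injective _)]

theorem isTree_attachLeaf [Finite ι] (hT : T.IsTree) : (attachLeaf T i₀).IsTree := by
  rw [SimpleGraph.isTree_iff_connected_and_card] at hT ⊢
  refine ⟨connected_attachLeaf hT.1, ?_⟩
  rw [card_edgeSet_attachLeaf, hT.2, Finite.card_option]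

end AttachLeaf

section PartialDecomposition

variable {V : Type*} {G : SimpleGraph V} {s : ℕ} {W X C : Set V}

/-- A tree decomposition of the subgraph of `G` that is induced by `W`, with bags of size at
most `s`. -/
structure PartialDecomposition (G : SimpleGraph V) (s : ℕ) (W : Set V) where
  ι : Type
  finiteNodes : Finite ι
  tree : SimpleGraph ι
  isTree : tree.IsTree
  bag : ι → Set V
  bag_subset : ∀ i, bag i ⊆ W
  ncard_bag_le : ∀ i, (bag i).ncard ≤ s
  edge_mem_bag : ∀ u ∈ W, ∀ v ∈ W, G.Adj u v → ∃ i, u ∈ bag i ∧ v ∈ bag i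
  connected_nodes : ∀ v ∈ W, (tree.induce {i | v ∈ bag i}).Connected

namespace PartialDecomposition

attribute [instance] finiteNodes

/-- The decomposition of the empty graph with one empty bag. -/
def empty : PartialDecomposition G s ∅ where
  ι := Unit
  finiteNodes := inferInstance
  tree := ⊥
  isTree := .of_subsingleton
  bag _ := ∅
  bag_subset _ := subset_rfl
  ncard_bag_le _ := by simp
  edge_mem_bag u hu := hu.elim
  connected_nodes v hv := hv.elim

/-- Attaching a leaf with the bag `insert w X` to a node whose bag contains `X`, where `w` is a new
vertex with all its old neighbours in `X`. -/
def insertLeaf (D : PartialDecomposition G s W) (i₀ : D.ι) (hX : X ⊆ D.bag i₀) {w : V}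
    (hw : w ∉ W) (hs : X.ncard + 1 ≤ s) (hN : ∀ v ∈ W, G.Adj w v → v ∈ X) :
    PartialDecomposition G s (insert w W) where
  ι := Option D.ι
  finiteNodes := inferInstance
  tree := attachLeaf D.tree i₀
  isTree := isTree_attachLeaf D.isTree
  bag i := i.elim (insert w X) D.bag
  bag_subset := by
    rintro (_ | i)
    · exact insert_subset_insert (hX.trans (D.bag_subset i₀))
    · exact (D.bag_subset i).trans (subset_insert _ _)
  ncard_bag_le := by
    rintro (_ | i)
    · exact (ncard_insert_le _ _).trans hs
    · exact D.ncard_bag_le i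
  edge_mem_bag := by
    rintro u (rfl | hu) v (rfl | hv) huv
    · exact (huv.ne rfl).elim
    · exact ⟨none, .inl rfl, .inr (hN v hv huv)⟩
    · exact ⟨none, .inr (hN u hu huv.symm), .inl rfl⟩
    · obtain ⟨i, hi⟩ := D.edge_mem_bag u hu v hv huv
      exact ⟨some i, hi⟩
  connected_nodes := by
    rintro v (rfl | hv)
    · have hnodes : {i : Option D.ι | v ∈ i.elim (insert v X) D.bag} = {none} := by
        ext (_ | i)
        · simp
        · simpa using fun hi => hw (D.bag_subset i hi)
      rw [hnodes]
      exact (SimpleGraph.IsTree.of_subsingleton).connected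
    · refine connected_induce_attachLeaf (D.connected_nodes v hv) (fun x => Iff.rfl) ?_
      exact fun h => hX (h.resolve_left fun hvw => hw (hvw ▸ hv))

/-- A tree decomposition of `G` from one of its subgraph induced by the set of all vertices. -/
noncomputable def toTreeDecomposition [Finite V] (D : PartialDecomposition G s univ) :
    TreeDecomposition G where
  ι := D.ι
  fintypeNodes := Fintype.ofFinite _
  tree := D.tree
  isTree := D.isTree
  bag i := (toFinite (D.bag i)).toFinset
  edge_mem_bag u v huv := by simpa using D.edge_mem_bag u (mem_univ _) v (mem_univ _) huv
  connected_nodes v := by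
    have hnodes : {i | v ∈ (toFinite (D.bag i)).toFinset} = {i | v ∈ D.bag i} := by ext; simp
    rw [hnodes]
    exact D.connected_nodes v (mem_univ _)

theorem width_toTreeDecomposition_le [Finite V] (D : PartialDecomposition G s univ) :
    D.toTreeDecomposition.width ≤ s - 1 := by
  refine Nat.sub_le_sub_right (Finset.sup_le fun i _ => ?_) 1
  exact (ncard_eq_toFinset_card _).symm.trans_le (D.ncard_bag_le i)

end PartialDecomposition

theorem Sweep.exists_partialDecomposition (h : Sweep G s X C) (D : PartialDecomposition G s W)
    (i₀ : D.ι) (hX : X ⊆ D.bag i₀) (hWC : Disjoint W C) (hC : Encloses G X C) :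
    ∃ D' : PartialDecomposition G s (W ∪ C), ∀ i, ∃ i', D.bag i ⊆ D'.bag i' := by
  induction h generalizing W with
  | nil X =>
    rw [union_empty]
    exact ⟨D, fun i => ⟨i, subset_rfl⟩⟩
  | @join X C₁ C₂ hdisj hadj _ _ ih₁ ih₂ =>
    rw [disjoint_union_right] at hWC
    obtain ⟨D₁, hD₁⟩ := ih₁ D i₀ hX hWC.1 (hC.left hadj)
    obtain ⟨i₁, hi₁⟩ := hD₁ i₀
    have hD₂ := ih₂ D₁ i₁ (hX.trans hi₁) (disjoint_union_left.2 ⟨hWC.2, hdisj⟩) (hC.right hadj)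
    rw [union_assoc] at hD₂
    obtain ⟨D₂, hD₂⟩ := hD₂
    refine ⟨D₂, fun i => ?_⟩
    obtain ⟨j, hj⟩ := hD₁ i
    obtain ⟨j', hj'⟩ := hD₂ j
    exact ⟨j', hj.trans hj'⟩
  | forget hX' hadj _ ih => exact ih D i₀ (hX'.trans hX) hWC (hC.of_forall_not_adj hadj)
  | @place X C w hw hs _ ih =>
    have hwW : w ∉ W := disjoint_right.1 hWC hw
    let D₁ := D.insertLeaf i₀ hX hwW hs fun v hv hwv =>
      (hC w hw v hwv).resolve_left (disjoint_left.1 hWC hv)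
    have hdisj : Disjoint (insert w W) (C \ {w}) :=
      disjoint_insert_left.2 ⟨fun h => h.2 rfl, hWC.mono_right sdiff_subset⟩
    have hD₁ := ih D₁ none subset_rfl hdisj (hC.insert_sdiff_singleton w)
    rw [insert_union, ← union_insert, Set.insert_sdiff_singleton, insert_eq_of_mem hw] at hD₁
    obtain ⟨D', hD'⟩ := hD₁
    exact ⟨D', fun i => hD' (some i)⟩

theorem treewidth_le_of_sweep [Finite V] (h : Sweep G s ∅ univ) : treewidth G ≤ s - 1 := by
  obtain ⟨D, -⟩ := h.exists_partialDecomposition .empty () subset_rfl (empty_disjoint _)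
    (.univ G ∅)
  rw [empty_union] at D
  have hmem : D.toTreeDecomposition.width ∈ {w | ∃ D : TreeDecomposition G, D.width = w} :=
    ⟨_, rfl⟩
  exact (Nat.sInf_le hmem).trans D.width_toTreeDecomposition_le

end PartialDecomposition

/-! ### The cop number -/

section Cops

variable {V : Type*}

/-- Two vertices are near if they are equal or adjacent: a player moves between near vertices. -/
def Near (G : SimpleGraph V) (x y : V) : Prop := y = x ∨ G.Adj x y

/-- A cop on `h x`, where `x` is the position of the robber, can answer each move of the robber to a
vertex `y` by going to `g y`. -/
def Follows (G : SimpleGraph V) (h g : V → V) : Prop :=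
  ∀ x y, Near G x y → Near G (h x) (g y)

/-- A cop who shadows the robber by `h` can change to the shadow `g` in finitely many moves, and
catches the robber if he goes to `N` in the meantime. -/
def Deforms (G : SimpleGraph V) (N : Set V) : (V → V) → (V → V) → Prop :=
  Relation.ReflTransGen fun h g => EqOn h id N ∧ EqOn g id N ∧ Follows G h g

/-- A cop who shadows the robber by `h` guards the vertices in `N`, and can retreat to each vertex
while still guarding it in case it lies in `N`. -/
structure Guards (G : SimpleGraph V) (N : Set V) (h : V → V) : Prop where
  eqOn : EqOn h id N
  follows : Follows G h h
  deforms : ∀ u, Deforms G (N ∩ {u}) h fun _ => u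

variable {G : SimpleGraph V} {X C N N' : Set V} {h h' : V → V} {s c : ℕ}

theorem Near.rfl {x : V} : Near G x x := .inl (Eq.refl x)

theorem Near.symm {x y : V} (h : Near G x y) : Near G y x :=
  h.imp Eq.symm SimpleGraph.Adj.symm

theorem near_getVert {u v : V} (p : G.Walk u v) {m n : ℕ} (hmn : m ≤ n + 1) (hnm : n ≤ m + 1) :
    Near G (p.getVert m) (p.getVert n) := by
  have near_succ (m : ℕ) : Near G (p.getVert m) (p.getVert (m + 1)) := by
    rcases lt_or_ge m p.length with hm | hm
    · exact .inr (p.adj_getVert_succ hm)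
    · exact .inl (by rw [p.getVert_of_length_le hm, p.getVert_of_length_le hm.step])
  rcases lt_trichotomy m n with hlt | rfl | hlt
  · exact (Nat.le_antisymm hlt hnm) ▸ near_succ m
  · exact .rfl
  · exact ((Nat.le_antisymm hlt hmn) ▸ near_succ n : Near G (p.getVert n) (p.getVert m)).symm

theorem Near.dist_le {x y : V} (hxy : Near G x y) (u : V) : G.dist u x ≤ G.dist u y + 1 := by
  rcases hxy with rfl | hadj
  · exact Nat.le_succ _
  · have := hadj.diff_dist_adj (u := u)
    omega

theorem Follows.symm (H : Follows G h h') : Follows G h' h :=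
  fun x y hxy => (H y x hxy.symm).symm

theorem Deforms.symm (H : Deforms G N h h') : Deforms G N h' h := by
  have : Std.Symm fun h h' => EqOn h id N ∧ EqOn h' id N ∧ Follows G h h' :=
    ⟨fun _ _ hstep => ⟨hstep.2.1, hstep.1, hstep.2.2.symm⟩⟩
  exact Relation.ReflTransGen.stdSymm.symm _ _ H

theorem Deforms.mono (H : Deforms G N h h') (hN : N' ⊆ N) : Deforms G N' h h' :=
  Relation.ReflTransGen.mono
    (fun _ _ hstep => ⟨hstep.1.mono hN, hstep.2.1.mono hN, hstep.2.2⟩) _ _ H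

theorem deforms_of_forall (f : ℕ → V → V) (n : ℕ) (hfix : ∀ t, EqOn (f t) id N)
    (hf : ∀ t, Follows G (f t) (f (t + 1))) : Deforms G N (f 0) (f n) := by
  induction n with
  | zero => exact .refl
  | succ n ih => exact ih.tail ⟨hfix n, hfix (n + 1), hf n⟩

theorem deforms_const (hG : G.Connected) (u v : V) :
    Deforms G ∅ (fun _ => u) fun _ => v := by
  obtain ⟨p⟩ := hG u v
  simpa using deforms_of_forall (fun t _ => p.getVert t) p.length (fun _ => eqOn_empty _ _)
    fun t _ _ _ => near_getVert p (by omega) (by omega)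

section PathShadow

variable {u w : V} {p : G.Walk u w}

variable (p) in
theorem deforms_const_getVert_dist :
    Deforms G {u} (fun _ => u) fun x => p.getVert (G.dist u x) := by
  have hlast (m : ℕ) : p.getVert (min m p.length) = p.getVert m := by
    rcases le_total m p.length with hm | hm
    · rw [min_eq_left hm]
    · rw [min_eq_right hm, p.getVert_of_length_le hm, p.getVert_length]
  have := deforms_of_forall (G := G) (N := {u}) (fun t x => p.getVert (min (G.dist u x) t))
    p.length (fun t => by simp) fun t x y hxy => by
      have := hxy.dist_le u
      have := hxy.symm.dist_le u
      exact near_getVert p (by omega) (by omega)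
  simpa only [Nat.min_zero, p.getVert_zero, hlast] using this

theorem deforms_getVert_dist_const (hp : p.length = G.dist u w) :
    Deforms G {w} (fun x => p.getVert (G.dist u x)) fun _ => w := by
  have hlast (m : ℕ) : p.getVert (max m p.length) = w := p.getVert_of_length_le (le_max_right _ _)
  have := deforms_of_forall (G := G) (N := {w}) (fun t x => p.getVert (max (G.dist u x) t))
    p.length (fun t => by
      rw [eqOn_singleton]
      exact p.getVert_of_length_le (hp.trans_le (le_max_left _ _))) fun t x y hxy => by
      have := hxy.dist_le u
      have := hxy.symm.dist_le u
      exact near_getVert p (by omega) (by omega)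
  simpa only [Nat.max_zero, hlast] using this

theorem guards_getVert_dist (hG : G.Connected) (hp : p.length = G.dist u w) :
    Guards G {u, w} fun x => p.getVert (G.dist u x) where
  eqOn := by
    rintro x (rfl | rfl)
    · simp
    · simp [← hp]
  follows x y hxy := near_getVert p (hxy.dist_le u) (hxy.symm.dist_le u)
  deforms v := by
    by_cases hvw : v = w
    · subst hvw
      exact (deforms_getVert_dist_const hp).mono inter_subset_right
    have hu := (deforms_const_getVert_dist p).symm
    by_cases hvu : v = u
    · subst hvu
      exact hu.mono inter_subset_right
    · rw [inter_singleton_eq_empty.2 (by simp [hvu, hvw])]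
      exact (hu.mono (empty_subset _)).trans (deforms_const hG u v)

end PathShadow

namespace Guards

theorem mono (H : Guards G N h) (hN : N' ⊆ N) : Guards G N' h :=
  ⟨H.eqOn.mono hN, H.follows, fun u => (H.deforms u).mono (inter_subset_inter_left _ hN)⟩

theorem const (hG : G.Connected) (v : V) : Guards G ∅ fun _ => v where
  eqOn := eqOn_empty _ _
  follows _ _ _ := .rfl
  deforms u := (deforms_const hG v u).mono inter_subset_left

theorem exists_deforms_insert (hG : G.Connected) (H : Guards G N h) (hN : N.Subsingleton) (w : V) :
    ∃ g, Deforms G N h g ∧ Guards G (insert w N) g := by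
  -- The cop retreats to the vertex that he guards, then spreads out over a shortest path to `w`.
  obtain ⟨u, hu⟩ : ∃ u, N ⊆ {u} := by
    rcases hN.eq_empty_or_singleton with rfl | ⟨u, rfl⟩
    exacts [⟨w, empty_subset _⟩, ⟨u, subset_rfl⟩]
  obtain ⟨p, hp⟩ := hG.exists_walk_length_eq_dist u w
  have hretreat := H.deforms u
  rw [inter_eq_left.2 hu] at hretreat
  refine ⟨_, hretreat.trans ((deforms_const_getVert_dist p).mono hu),
    (guards_getVert_dist hG hp).mono ?_⟩
  rw [pair_comm]
  exact insert_subset_insert hu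

end Guards

/-- Cops on `p` can catch a robber on `r` who is next to move. -/
def RobberLoses (G : SimpleGraph V) (p : Fin c → V) (r : V) : Prop :=
  ∀ r', Near G r r' → CopsCatch G p r'

theorem CopsCatch.of_near {p : Fin c → V} {r : V} (i : Fin c) (hi : Near G (p i) r) :
    CopsCatch G p r := by
  classical
  refine .capture p (Function.update p i r) r (fun j => ?_) i (Function.update_self ..)
  rcases eq_or_ne j i with rfl | hne
  · rwa [Function.update_self]
  · exact .inl (Function.update_of_ne hne ..)

theorem robberLoses_of_follows {f f' : Fin c → V → V} (hf : ∀ i, Follows G (f i) (f' i))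
    (hX : ∀ x ∈ X, ∃ i, f' i x = x) (hC : Encloses G X C)
    (hf' : ∀ r ∈ C, RobberLoses G (fun i => f' i r) r) {r : V} (hr : r ∈ C) :
    RobberLoses G (fun i => f i r) r := by
  intro r' hrr'
  have hr' : r' ∈ C ∨ r' ∈ X := hrr'.elim (fun h => .inl (h ▸ hr)) (hC r hr r')
  rcases hr' with hr' | hr'
  · exact .step _ (fun i => f' i r') r' (fun i => hf i r r' hrr') (hf' r' hr')
  · obtain ⟨i, hi⟩ := hX r' hr'
    have hnear := hf i r r' hrr'
    rw [hi] at hnear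
    exact .of_near i hnear

theorem robberLoses_of_deforms {f : Fin c → V → V} {i : Fin c} (H : Deforms G N h h')
    (hf : ∀ j ≠ i, Follows G (f j) (f j)) (hX : ∀ x ∈ X, x ∈ N ∨ ∃ j ≠ i, f j x = x)
    (hC : Encloses G X C) (hh' : ∀ r ∈ C, RobberLoses G (fun j => Function.update f i h' j r) r) :
    ∀ r ∈ C, RobberLoses G (fun j => Function.update f i h j r) r := by
  induction H using Relation.ReflTransGen.head_induction_on with
  | refl => exact hh'
  | @head g g₁ hstep _ ih =>
    intro r hr
    refine robberLoses_of_follows (f := Function.update f i g) (f' := Function.update f i g₁)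
      (fun j => ?_) (fun x hx => ?_) hC ih hr
    · rcases eq_or_ne j i with rfl | hne
      · simpa only [Function.update_self] using hstep.2.2
      · simpa only [Function.update_of_ne hne] using hf j hne
    · rcases hX x hx with hxN | ⟨j, hne, hj⟩
      · exact ⟨i, by rw [Function.update_self]; exact hstep.2.1 hxN⟩
      · exact ⟨j, by rwa [Function.update_of_ne hne]⟩

/-- The cops who shadow the robber by `f` can share the task of guarding `X` in such a way that
none of them is responsible for more than two vertices. -/
def IsBlockade (G : SimpleGraph V) (X : Set V) (f : Fin c → V → V) : Prop :=
  ∃ a : V → Fin c, ∀ i, {x ∈ X | a x = i}.ncard ≤ 2 ∧ Guards G {x ∈ X | a x = i} (f i)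

theorem exists_ncard_fiber_lt [Finite V] (a : V → Fin c) {n : ℕ} (hX : X.ncard < c * n) :
    ∃ i, {x ∈ X | a x = i}.ncard < n := by
  classical
  have hfin := toFinite X
  obtain ⟨i, -, hi⟩ := Finset.exists_card_fiber_lt_of_card_lt_mul (f := a) (s := hfin.toFinset)
    (t := Finset.univ) (n := n) (by rwa [← ncard_eq_toFinset_card, Finset.card_fin])
  refine ⟨i, lt_of_eq_of_lt ?_ hi⟩
  rw [← ncard_coe_finset]
  simp

namespace IsBlockade

variable {f : Fin c → V → V}

theorem mono [Finite V] {X' : Set V} (hf : IsBlockade G X f) (hX : X' ⊆ X) :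
    IsBlockade G X' f := by
  obtain ⟨a, ha⟩ := hf
  have hsub (i : Fin c) : {x ∈ X' | a x = i} ⊆ {x ∈ X | a x = i} := fun x hx => ⟨hX hx.1, hx.2⟩
  exact ⟨a, fun i => ⟨(ncard_le_ncard (hsub i)).trans (ha i).1, (ha i).2.mono (hsub i)⟩⟩

theorem exists_apply_eq (hf : IsBlockade G X f) {x : V} (hx : x ∈ X) : ∃ i, f i x = x := by
  obtain ⟨a, ha⟩ := hf
  exact ⟨a x, (ha (a x)).2.eqOn ⟨hx, rfl⟩⟩

theorem update [Finite V] {a : V → Fin c} {i : Fin c} {w : V} {g : V → V}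
    (ha : ∀ i, {x ∈ X | a x = i}.ncard ≤ 2 ∧ Guards G {x ∈ X | a x = i} (f i))
    (hi : {x ∈ X | a x = i}.ncard < 2) (hg : Guards G (insert w {x ∈ X | a x = i}) g) :
    IsBlockade G (insert w X) (Function.update f i g) := by
  classical
  refine ⟨Function.update a w i, fun j => ?_⟩
  rcases eq_or_ne j i with rfl | hne
  · have hsub : {x ∈ insert w X | Function.update a w j x = j} ⊆
        insert w {x ∈ X | a x = j} := by
      rintro x ⟨hx, hxj⟩
      rcases eq_or_ne x w with rfl | hxw
      · exact .inl rfl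
      · exact .inr ⟨hx.resolve_left hxw, by rwa [Function.update_of_ne hxw] at hxj⟩
    rw [Function.update_self]
    exact ⟨(ncard_le_ncard hsub).trans ((ncard_insert_le _ _).trans hi), hg.mono hsub⟩
  · have hsub : {x ∈ insert w X | Function.update a w i x = j} ⊆ {x ∈ X | a x = j} := by
      rintro x ⟨hx, hxj⟩
      rcases eq_or_ne x w with rfl | hxw
      · exact (hne (by rw [← hxj, Function.update_self])).elim
      · exact ⟨hx.resolve_left hxw, by rwa [Function.update_of_ne hxw] at hxj⟩
    rw [Function.update_of_ne hne]
    exact ⟨(ncard_le_ncard hsub).trans (ha j).1, (ha j).2.mono hsub⟩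

theorem robberLoses_of_insert [Finite V] (hG : G.Connected) (hf : IsBlockade G X f)
    (hX : X.ncard < c * 2) (hC : Encloses G X C) {w : V}
    (hwin : ∀ f' : Fin c → V → V, IsBlockade G (insert w X) f' →
      ∀ r ∈ C \ {w}, RobberLoses G (fun i => f' i r) r) :
    ∀ r ∈ C, RobberLoses G (fun i => f i r) r := by
  obtain ⟨a, ha⟩ := hf
  obtain ⟨i, hi⟩ := exists_ncard_fiber_lt a hX
  obtain ⟨g, hdef, hg⟩ := (ha i).2.exists_deforms_insert hG
    (ncard_le_one_iff_subsingleton.1 (Nat.lt_succ_iff.1 hi)) w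
  have hblock := update ha hi hg
  have := robberLoses_of_deforms (f := f) (i := i) (X := X) hdef (fun j _ => (ha j).2.follows)
    (fun x hx => ?_) hC (fun r hr => ?_)
  · rwa [Function.update_eq_self] at this
  · by_cases hxi : a x = i
    · exact .inl ⟨hx, hxi⟩
    · exact .inr ⟨a x, hxi, (ha (a x)).2.eqOn ⟨hx, rfl⟩⟩
  · rcases eq_or_ne r w with rfl | hrw
    · obtain ⟨j, hj⟩ := hblock.exists_apply_eq (.inl rfl)
      exact fun r' hr' => .of_near j (by rwa [hj])
    · exact hwin _ hblock r ⟨hr, hrw⟩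

end IsBlockade

theorem Sweep.robberLoses [Finite V] (H : Sweep G s X C) (hG : G.Connected) (hs : s ≤ c * 2)
    (hC : Encloses G X C) {f : Fin c → V → V} (hf : IsBlockade G X f) :
    ∀ r ∈ C, RobberLoses G (fun i => f i r) r := by
  induction H generalizing f with
  | nil => exact fun r hr => hr.elim
  | join _ hadj _ _ ih₁ ih₂ =>
    rintro r (hr | hr)
    · exact ih₁ (hC.left hadj) hf r hr
    · exact ih₂ (hC.right hadj) hf r hr
  | forget hX hadj _ ih => exact ih (hC.of_forall_not_adj hadj) (hf.mono hX)
  | place w _ hXs _ ih =>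
    exact hf.robberLoses_of_insert hG (hXs.trans hs) hC
      fun f' hf' => ih (hC.insert_sdiff_singleton w) hf'

theorem copNumber_le_of_sweep [Finite V] (hG : G.Connected) (hs : 0 < s)
    (H : Sweep G s ∅ univ) : copNumber G ≤ (s + 1) / 2 := by
  obtain ⟨v⟩ := hG.nonempty
  have hstart : IsBlockade G ∅ fun (_ : Fin ((s + 1) / 2)) (_ : V) => v :=
    ⟨fun _ => ⟨0, by omega⟩, fun i => ⟨by simp, (Guards.const hG v).mono (by simp)⟩⟩
  refine Nat.sInf_le ⟨fun _ => v, fun r => ?_⟩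
  exact H.robberLoses hG (by omega) (.univ G ∅) hstart r (mem_univ r) r .rfl

end Cops

/-! ### Outer `k`-planar graphs -/

theorem ConvexDrawing.IsOuterKPlanar.crossNum_le {V : Type*} [Finite V] [LinearOrder V]
    {D : ConvexDrawing V} {G : SimpleGraph V} {k : ℕ} (hD : D.IsOuterKPlanar G k)
    (hmono : StrictMono D.angle) {u v : V} (hadj : G.Adj u v) : crossNum G u v ≤ k := by
  have hinj : InjOn (fun e : V × V => s(e.1, e.2)) (edgesBetween G (Ioo u v) (Icc u v)ᶜ) := by
    rintro ⟨a, b⟩ ⟨ha, -, -⟩ ⟨c, d⟩ ⟨-, hd, -⟩ h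
    rcases Sym2.eq_iff.1 h with ⟨hac, hbd⟩ | ⟨had, -⟩
    · exact Prod.ext hac hbd
    · exact (hd (had ▸ Ioo_subset_Icc_self ha)).elim
  rw [crossNum, numEdges, ← hinj.ncard_image, ← Nat.cast_le (α := ℕ∞),
    (toFinite _).cast_ncard_eq]
  refine (encard_le_encard ?_).trans (hD s(u, v) hadj)
  rintro _ ⟨⟨a, b⟩, ⟨⟨hua, hav⟩, hb, hab⟩, rfl⟩
  refine ⟨hab, (?_ : D.Crosses s(u, v) s(a, b))⟩
  rcases lt_or_ge b u with hbu | hub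
  · rw [Sym2.eq_swap (a := a)]
    exact (D.crosses_of_angle_lt (hmono hbu) (hmono hua) (hmono hav)).symm
  · have hvb : v < b := lt_of_not_ge fun hbv => hb ⟨hub, hbv⟩
    exact D.crosses_of_angle_lt (hmono hua) (hmono hav) (hmono hvb)

theorem IsOuterKPlanar.sweep {V : Type*} [Finite V] {G : SimpleGraph V} {k : ℕ}
    (hG : IsOuterKPlanar G k) : Sweep G (3 * k / 2 + 3) ∅ univ := by
  obtain ⟨D, hD⟩ := hG
  let _ : LinearOrder V := LinearOrder.lift' D.angle D.angle_injective
  exact sweep_univ fun u v _ hadj => hD.crossNum_le (fun _ _ h => h) hadj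

end OuterKPlanar

theorem mainTheorem1 {V : Type*} [Finite V] (G : SimpleGraph V) (k : ℕ)
    (hG : OuterKPlanar.IsOuterKPlanar G k) :
    (OuterKPlanar.treewidth G : ℝ) ≤ 1.5 * k + 2 ∧
      (G.Connected →
        (OuterKPlanar.copNumber G : ℝ) ≤ 0.75 * k + 2 ∧
        (¬ 4 ∣ k → (OuterKPlanar.copNumber G : ℝ) ≤ 0.75 * k + 1.75)) := by
  have htw := OuterKPlanar.treewidth_le_of_sweep hG.sweep
  refine ⟨?_, fun hconn => ?_⟩
  · have h : 2 * (OuterKPlanar.treewidth G : ℝ) ≤ 3 * k + 4 := by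
      exact_mod_cast (by omega : 2 * OuterKPlanar.treewidth G ≤ 3 * k + 4)
    linarith
  have hcop : 4 * OuterKPlanar.copNumber G ≤ 3 * k + 8 := by
    have := OuterKPlanar.copNumber_le_of_sweep hconn (by omega) hG.sweep
    omega
  refine ⟨?_, fun hk => ?_⟩
  · have h : 4 * (OuterKPlanar.copNumber G : ℝ) ≤ 3 * k + 8 := by exact_mod_cast hcop
    linarith
  · have h : 4 * (OuterKPlanar.copNumber G : ℝ) ≤ 3 * k + 7 := by
      exact_mod_cast (by omega : 4 * OuterKPlanar.copNumber G ≤ 3 * k + 7)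
    linarith
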